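/- Let $k \ge 3$ and let $a, b \in \{0, \dots, k-1\}$. A finite $k$-poset is a finite partially ordered set $P$ together with a labelling $c \colon P \to \{0, \dots, k-1\}$; it is a $k$-lattice if the underlying poset is a lattice. A homomorphism $(P,c) \to (P',c')$ is an order-preserving map $h \colon P \to P'$ with $c = c' \circ h$; write $(P,c) \le (P',c')$ if such a homomorphism exists, and $(P,c) \equiv (P',c')$ if $(P,c) \le (P',c')$ and $(P',c') \le (P,c)$. Let $\mathcal{P}_k^{ab}$ be the class of all finite $k$-posets that have a largest element, labelled $a$, and a smallest element, labelled $b$, and let $\mathcal{L}_k^{ab}$ be the class of all $k$-lattices in $\mathcal{P}_k^{ab}$. Let $\tilde{\mathcal{P}}_k^{ab} = \mathcal{P}_k^{ab}/{\equiv}$ and $\tilde{\mathcal{L}}_k^{ab} = \mathcal{L}_k^{ab}/{\equiv}$, partially ordered by the order induced by $\le$. Theorem. The posets $\tilde{\mathcal{P}}_k^{ab}$ and $\tilde{\mathcal{L}}_k^{ab}$ are universal, that is, each of them is countable, and every countable poset $Y$ embeds into each of them (there is a map $f$ from $Y$ with $x \le y \iff f(x) \le f(y)$). -/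

import Mathlib

universe u v

/-- A finite `k`-poset: a finite partially ordered set whose elements are labelled by
`0, ..., k - 1`. Every finite poset is isomorphic to one whose carrier lives in `Type`. -/
structure FinKPoset (k : ℕ) where
  /-- the underlying set -/
  carrier : Type
  [partialOrder : PartialOrder carrier]
  [finite : Finite carrier]
  /-- the labelling -/
  label : carrier → Fin k

namespace FinKPoset

variable {k : ℕ}

instance : CoeSort (FinKPoset k) Type := ⟨carrier⟩

instance (P : FinKPoset k) : PartialOrder P := P.partialOrder

instance (P : FinKPoset k) : Finite P := P.finite

/-- A homomorphism of `k`-posets: an order-preserving map that also preserves labels. -/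
structure Hom (P Q : FinKPoset k) extends P.carrier →o Q.carrier where
  label_eq : ∀ x : P, Q.label (toFun x) = P.label x

/-- The homomorphism quasiorder: `P ≤ Q` iff there is a homomorphism of `P` to `Q`. -/
instance : Preorder (FinKPoset k) where
  le P Q := Nonempty (Hom P Q)
  le_refl P := ⟨⟨OrderHom.id, fun _ => rfl⟩⟩
  le_trans P Q R := fun ⟨f⟩ ⟨g⟩ =>
    ⟨⟨g.toOrderHom.comp f.toOrderHom, fun x => (g.label_eq _).trans (f.label_eq x)⟩⟩

/-- `P` has a largest element, with label `a`, and a smallest element, with label `b`. -/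
def IsBoundedWithLabels (a b : Fin k) (P : FinKPoset k) : Prop :=
  (∃ t : P, IsTop t ∧ P.label t = a) ∧ (∃ s : P, IsBot s ∧ P.label s = b)

/-- `P` is a `k`-lattice: its underlying poset is a (nonempty) lattice, i.e. any two elements
have a supremum and an infimum. -/
def IsKLattice (P : FinKPoset k) : Prop :=
  Nonempty P ∧ ∀ x y : P, (∃ s : P, IsLUB {x, y} s) ∧ (∃ i : P, IsGLB {x, y} i)

end FinKPoset

/-- The class of finite bounded `k`-posets whose top has label `a` and whose bottom has label `b`,
with the homomorphism quasiorder. -/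
abbrev BoundedKPoset (k : ℕ) (a b : Fin k) : Type 1 :=
  {P : FinKPoset k // P.IsBoundedWithLabels a b}

/-- The class of finite `k`-lattices whose top has label `a` and whose bottom has label `b`,
with the homomorphism quasiorder. -/
abbrev BoundedKLattice (k : ℕ) (a b : Fin k) : Type 1 :=
  {P : FinKPoset k // P.IsKLattice ∧ P.IsBoundedWithLabels a b}

/-- The homomorphism order on `BoundedKPoset k a b`: its quotient by homomorphic equivalence
(`P ≤ Q` and `Q ≤ P`), with the induced partial order. -/
abbrev BoundedKPosetOrder (k : ℕ) (a b : Fin k) : Type 1 :=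
  Antisymmetrization (BoundedKPoset k a b) (· ≤ ·)

/-- The homomorphism order on `BoundedKLattice k a b`: its quotient by homomorphic equivalence,
with the induced partial order. -/
abbrev BoundedKLatticeOrder (k : ℕ) (a b : Fin k) : Type 1 :=
  Antisymmetrization (BoundedKLattice k a b) (· ≤ ·)

/-- A universal poset: a countable poset into which every countable poset embeds, where an
embedding satisfies `f x ≤ f y ↔ x ≤ y`. -/
def IsUniversalPoset (X : Type v) [PartialOrder X] : Prop :=
  Countable X ∧ ∀ (Y : Type u) [PartialOrder Y] [Countable Y], Nonempty (Y ↪o X)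

/-!
Bounded `k`-lattices encode finite sets of positive integers ordered by
"every element of `A` has a divisor in `B`", and that order is already universal.

*Lattices from cycles.* Let `s` be a self-map of `X` and `χ : X → ℤ/3` a colouring with
`χ (s x) = χ x + 1`. The poset `Crown s` puts a chain of four elements over each `x : X`, lets the
lower half of the chain of `x` lie below the upper half of the chain of `s x`, and adds a top and a
bottom. For injective `s` it is a lattice. With three labels available, the labels can be chosen so
that consecutive elements of every maximal chain have different labels, whatever the labels of top
and bottom are. A homomorphism is therefore strictly increasing on maximal chains, so it preserves
levels, and the labels of the two middle levels force it to come from a map `X → Y` commuting with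
the self-maps (`exists_semiconj_of_hom`). When `X` and `Y` are disjoint unions of cycles of lengths
`3 n`, `n ∈ A`, and `3 m`, `m ∈ B`, such a map exists exactly if every `n ∈ A` is a multiple of
some `m ∈ B` (`cycleLattice_le_iff`).

*Universality of the divisibility order.* Enumerate a countable poset `Y` and send `y` to the
family of those finite sets `S`, contained in the part of `Y` enumerated up to `y`, which contain an
element below `y` and are up-closed within an initial segment of the enumeration. If `y ≤ z`, each
member `S` of the family of `y` has a subset in the family of `z`: either `S` itself or the part of
`S` enumerated up to `z`. Conversely the part of `{t | y ≤ t}` enumerated up to `y` witnesses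
`y ≤ z`. Coding finite sets by products of distinct primes turns inclusion into divisibility
(`exists_divisor_representation`).
-/

/-! ### The divisibility order on finite sets of positive integers -/

/-- The product of the primes whose indices lie in `S`. -/
noncomputable def primeCode (S : Finset ℕ) : ℕ+ :=
  ∏ i ∈ S, ⟨Nat.nth Nat.Prime i, (Nat.prime_nth_prime i).pos⟩

lemma coe_primeCode (S : Finset ℕ) : (primeCode S : ℕ) = ∏ i ∈ S, Nat.nth Nat.Prime i := by
  exact map_prod PNat.coeMonoidHom _ S

lemma primeCode_dvd_iff {S T : Finset ℕ} : (primeCode S : ℕ) ∣ primeCode T ↔ S ⊆ T := by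
  rw [coe_primeCode, coe_primeCode]
  refine ⟨fun h i hi => ?_, fun h => Finset.prod_dvd_prod_of_subset _ _ _ h⟩
  have h1 := (Finset.dvd_prod_of_mem (Nat.nth Nat.Prime) hi).trans h
  obtain ⟨j, hj, hij⟩ := ((Nat.prime_nth_prime i).prime.dvd_finsetProd_iff _).1 h1
  have h2 := (Nat.prime_dvd_prime_iff_eq (Nat.prime_nth_prime i) (Nat.prime_nth_prime j)).1 hij
  rwa [Nat.nth_injective Nat.infinite_setOfPred_prime h2]

/-- The finite sets representing `y` with respect to an enumeration `e` of a poset: they lie in the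
part enumerated up to `y`, contain an element below `y`, and are up-closed within an initial segment
of the enumeration. -/
def IsApprox {Y : Type*} [PartialOrder Y] (e : Y → ℕ) (y : Y) (S : Set Y) : Prop :=
  (∀ s ∈ S, e s ≤ e y) ∧ (∃ j ∈ S, j ≤ y) ∧
    ∀ i ∈ S, ∀ s ∈ S, ∀ l, e l ≤ e s → i ≤ l → l ∈ S

/-- The order is recovered from the approximating sets. If `y ≤ z`, an approximation `S` of `y` all
of whose elements are enumerated up to `z` approximates `z`; otherwise up-closedness puts `z` itself
into `S`, so that cutting `S` at `z` leaves an approximation of `z`. -/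
lemma le_iff_forall_isApprox {Y : Type*} [PartialOrder Y] (e : Y → ℕ) (y z : Y) :
    y ≤ z ↔ ∀ S, IsApprox e y S → ∃ T, IsApprox e z T ∧ T ⊆ S := by
  constructor
  · rintro hyz S ⟨_, ⟨j, hj, hjy⟩, h3⟩
    by_cases hS : ∀ s ∈ S, e s ≤ e z
    · exact ⟨S, ⟨hS, ⟨j, hj, hjy.trans hyz⟩, h3⟩, subset_rfl⟩
    · push Not at hS
      obtain ⟨t, ht, hzt⟩ := hS
      refine ⟨{s ∈ S | e s ≤ e z}, ⟨fun s hs => hs.2, ⟨z, ⟨?_, le_rfl⟩, le_rfl⟩, ?_⟩,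
        fun s hs => hs.1⟩
      · exact h3 j hj t ht z hzt.le (hjy.trans hyz)
      · exact fun i hi s hs l hl hil => ⟨h3 i hi.1 s hs.1 l hl hil, hl.trans hs.2⟩
  · intro h
    obtain ⟨T, ⟨_, ⟨j, hj, hjz⟩, _⟩, hT⟩ := h {t | y ≤ t ∧ e t ≤ e y}
      ⟨fun s hs => hs.2, ⟨y, ⟨le_rfl, le_rfl⟩, le_rfl⟩,
        fun i hi s hs l hl hil => ⟨hi.1.trans hil, hl.trans hs.2⟩⟩
    exact (hT hj).1.trans hjz

/-- Every countable poset embeds into the finite sets of positive integers, quasi-ordered by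
"every element of `A` has a divisor in `B`". -/
lemma exists_divisor_representation (Y : Type*) [PartialOrder Y] [Countable Y] :
    ∃ f : Y → Finset ℕ+, ∀ y z, y ≤ z ↔ ∀ n ∈ f y, ∃ m ∈ f z, (m : ℕ) ∣ n := by
  classical
  obtain ⟨e, he⟩ := exists_injective_nat Y
  let f (y : Y) : Finset ℕ+ :=
    ((Finset.range (e y + 1)).powerset.filter fun A : Finset ℕ =>
      (A : Set ℕ) ⊆ Set.range e ∧ IsApprox e y (e ⁻¹' A)).image primeCode
  have mem_f (y : Y) (n : ℕ+) : n ∈ f y ↔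
      ∃ A : Finset ℕ, (A : Set ℕ) ⊆ Set.range e ∧ IsApprox e y (e ⁻¹' A) ∧ primeCode A = n := by
    simp only [f, Finset.mem_image, Finset.mem_filter, Finset.mem_powerset]
    constructor
    · rintro ⟨A, ⟨_, h1, h2⟩, h3⟩
      exact ⟨A, h1, h2, h3⟩
    · rintro ⟨A, h1, h2, h3⟩
      refine ⟨A, ⟨fun i hi => ?_, h1, h2⟩, h3⟩
      obtain ⟨s, rfl⟩ := h1 hi
      exact Finset.mem_range_succ_iff.2 (h2.1 s hi)
  -- every approximating set is finite, hence coded by a finite set of indices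
  have code (y : Y) (S : Set Y) (hS : IsApprox e y S) :
      ∃ A : Finset ℕ, (A : Set ℕ) ⊆ Set.range e ∧ e ⁻¹' A = S := by
    have hfin : (e '' S).Finite := (Set.finite_Iic (e y)).subset (by
      rintro _ ⟨s, hs, rfl⟩
      exact hS.1 s hs)
    refine ⟨hfin.toFinset, ?_, ?_⟩
    · rw [hfin.coe_toFinset]
      exact Set.image_subset_range e S
    · rw [hfin.coe_toFinset, he.preimage_image]
  refine ⟨f, fun y z => (le_iff_forall_isApprox e y z).trans ⟨fun h n hn => ?_, fun h S hS => ?_⟩⟩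
  · obtain ⟨A, hA, hyA, rfl⟩ := (mem_f y n).1 hn
    obtain ⟨T, hT, hTA⟩ := h _ hyA
    obtain ⟨B, hB, rfl⟩ := code z T hT
    refine ⟨_, (mem_f z _).2 ⟨B, hB, hT, rfl⟩, primeCode_dvd_iff.2 fun i hi => ?_⟩
    obtain ⟨s, rfl⟩ := hB hi
    exact hTA hi
  · obtain ⟨A, hA, rfl⟩ := code y S hS
    obtain ⟨m, hm, hmA⟩ := h _ ((mem_f y _).2 ⟨A, hA, hS, rfl⟩)
    obtain ⟨B, hB, hzB, rfl⟩ := (mem_f z m).1 hm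
    exact ⟨_, hzB, fun s hs => primeCode_dvd_iff.1 hmA hs⟩

/-! ### The lattice of a self-map -/

/-- The points of the poset attached to a self-map `s` of `X`: a bottom, a top, and a chain of four
points over each `x : X`. The map `s` enters through the order only. -/
inductive Crown {X : Type} (s : X → X) : Type
  | bot : Crown s
  | mid (x : X) (l : Fin 4) : Crown s
  | top : Crown s

namespace Crown

variable {X Y : Type} {s : X → X} {t : Y → Y}

/-- The order of `Crown s`: levels `0, 1` over `x` lie below levels `2, 3` over `x` and over
`s x`. -/
inductive Le (s : X → X) : Crown s → Crown s → Prop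
  | bot (p : Crown s) : Le s bot p
  | top (p : Crown s) : Le s p top
  | chain (x : X) {l m : Fin 4} (h : l ≤ m) : Le s (mid x l) (mid x m)
  | cross (x : X) {l m : Fin 4} (hl : l ≤ 1) (hm : 2 ≤ m) : Le s (mid x l) (mid (s x) m)

instance : PartialOrder (Crown s) where
  le := Le s
  le_refl p := by
    cases p
    · exact .bot _
    · exact .chain _ le_rfl
    · exact .top _
  le_trans p q r hpq hqr := by
    cases hpq with
    | bot => exact .bot _
    | top => cases hqr; exact .top _
    | chain x h =>
      cases hqr with
      | top => exact .top _
      | chain _ h' => exact .chain x (h.trans h')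
      | cross _ hl hm => exact .cross x (h.trans hl) hm
    | cross x hl hm =>
      cases hqr with
      | top => exact .top _
      | chain _ h' => exact .cross x hl (hm.trans h')
      | cross _ hl' _ => exact absurd (hm.trans hl') (by decide)
  le_antisymm p q hpq hqp := by
    have key : ∀ x y l m, Le s (mid x l) (mid y m) → l ≤ m ∧ (m ≤ l → x = y) := by
      intro x y l m h
      cases h with
      | chain _ h => exact ⟨h, fun _ => rfl⟩
      | cross _ hl hm =>
        exact ⟨hl.trans ((by decide : (1 : Fin 4) ≤ 2).trans hm),
          fun h => absurd ((hm.trans h).trans hl) (by decide)⟩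
    match p, q, hpq, hqp with
    | .bot, .bot, _, _ => rfl
    | .top, .top, _, _ => rfl
    | .mid x l, .mid y m, h, h' =>
      obtain ⟨h1, h2⟩ := key _ _ _ _ h
      obtain ⟨h3, _⟩ := key _ _ _ _ h'
      rw [h2 h3, le_antisymm h1 h3]

lemma mid_le_mid_iff {x y : X} {l m : Fin 4} : (mid x l : Crown s) ≤ mid y m ↔
    (x = y ∧ l ≤ m) ∨ (y = s x ∧ l ≤ 1 ∧ 2 ≤ m) := by
  constructor
  · intro h
    cases h with
    | chain _ h => exact .inl ⟨rfl, h⟩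
    | cross _ hl hm => exact .inr ⟨rfl, hl, hm⟩
  · rintro (⟨rfl, h⟩ | ⟨rfl, hl, hm⟩)
    · exact .chain _ h
    · exact .cross _ hl hm

lemma isBot_bot : IsBot (bot : Crown s) := fun p => .bot p

lemma isTop_top : IsTop (top : Crown s) := fun p => .top p

lemma not_mid_le_bot (x : X) (l : Fin 4) : ¬ (mid x l : Crown s) ≤ bot := fun h => by cases h

lemma not_top_le_mid (x : X) (l : Fin 4) : ¬ (top : Crown s) ≤ mid x l := fun h => by cases h

lemma not_top_le_bot : ¬ (top : Crown s) ≤ bot := fun h => by cases h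

instance [Finite X] : Finite (Crown s) := by
  refine Finite.of_surjective
    (fun o : Option (Option (X × Fin 4)) => match o with
      | none => bot
      | some none => top
      | some (some (x, l)) => mid x l) fun p => ?_
  cases p with
  | bot => exact ⟨none, rfl⟩
  | mid x l => exact ⟨some (some (x, l)), rfl⟩
  | top => exact ⟨some none, rfl⟩

/-- The level of a point: its position in the six-element chain from bottom to top through some
`x : X`, counted from `0`. -/
def rank : Crown s → ℕ
  | bot => 0
  | mid _ l => l + 1
  | top => 5

lemma rank_strictMono : StrictMono (rank : Crown s → ℕ) := by
  have key (p q : Crown s) (h : p ≤ q) : p = q ∨ p.rank < q.rank := by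
    cases h with
    | bot => cases q <;> simp [rank]
    | top => cases p <;> simp [rank]; omega
    | chain x h =>
      rcases h.eq_or_lt with rfl | h
      · exact .inl rfl
      · exact .inr (by simpa [rank] using h)
    | cross x hl hm => exact .inr (by simp only [rank]; omega)
  exact fun p q h => (key p q h.le).resolve_left h.ne

lemma exists_isLUB (hs : s.Injective) (hs2 : ∀ x, s (s x) ≠ x) (p q : Crown s) :
    ∃ r, IsLUB {p, q} r := by
  have of_le {p q : Crown s} (h : p ≤ q) : IsLUB {p, q} q :=
    ⟨by simp [h], fun r hr => hr (by simp)⟩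
  have swap {p q r : Crown s} (h : IsLUB {p, q} r) : IsLUB {q, p} r := by rwa [Set.pair_comm]
  -- chains over `y` and `s y`
  have adj (y : X) (l m : Fin 4) (hm : m ≤ 1) :
      IsLUB {mid (s y) l, mid y m} (mid (s y) (max l 2) : Crown s) := by
    refine ⟨?_, fun r hr => ?_⟩
    · simp [mid_le_mid_iff, hm]
    · have h1 : mid (s y) l ≤ r := hr (by simp)
      have h2 : mid y m ≤ r := hr (by simp)
      cases r with
      | bot => exact absurd h1 (not_mid_le_bot _ _)
      | top => exact isTop_top _
      | mid z n =>
        rw [mid_le_mid_iff] at h1 h2 ⊢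
        grind
  match p, q with
  | .bot, q => exact ⟨q, of_le (isBot_bot q)⟩
  | p, .bot => exact ⟨p, swap (of_le (isBot_bot p))⟩
  | .top, q => exact ⟨top, swap (of_le (isTop_top q))⟩
  | p, .top => exact ⟨top, of_le (isTop_top p)⟩
  | .mid x l, .mid y m =>
    by_cases hxy : x = y
    · subst hxy
      rcases le_total l m with h | h
      · exact ⟨_, of_le (mid_le_mid_iff.2 (.inl ⟨rfl, h⟩))⟩
      · exact ⟨_, swap (of_le (mid_le_mid_iff.2 (.inl ⟨rfl, h⟩)))⟩
    by_cases h1 : x = s y ∧ m ≤ 1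
    · obtain ⟨rfl, hm⟩ := h1
      exact ⟨_, adj y l m hm⟩
    by_cases h2 : y = s x ∧ l ≤ 1
    · obtain ⟨rfl, hl⟩ := h2
      exact ⟨_, swap (adj x m l hl)⟩
    refine ⟨top, fun r _ => isTop_top r, fun r hr => ?_⟩
    have h3 : mid x l ≤ r := hr (by simp)
    have h4 : mid y m ≤ r := hr (by simp)
    cases r with
    | bot => exact absurd h3 (not_mid_le_bot _ _)
    | top => exact le_rfl
    | mid z n =>
      rw [mid_le_mid_iff] at h3 h4
      have := @hs x y
      grind

lemma exists_isGLB (hs : s.Injective) (hs2 : ∀ x, s (s x) ≠ x) (p q : Crown s) :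
    ∃ r, IsGLB {p, q} r := by
  have of_le {p q : Crown s} (h : p ≤ q) : IsGLB {p, q} p :=
    ⟨by simp [h], fun r hr => hr (by simp)⟩
  have swap {p q r : Crown s} (h : IsGLB {p, q} r) : IsGLB {q, p} r := by rwa [Set.pair_comm]
  -- chains over `x` and `s x`
  have adj (x : X) (l m : Fin 4) (hm : 2 ≤ m) :
      IsGLB {mid x l, mid (s x) m} (mid x (min l 1) : Crown s) := by
    refine ⟨?_, fun r hr => ?_⟩
    · simp [mid_le_mid_iff, hm]
    · have h1 : r ≤ mid x l := hr (by simp)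
      have h2 : r ≤ mid (s x) m := hr (by simp)
      cases r with
      | bot => exact isBot_bot _
      | top => exact absurd h1 (not_top_le_mid _ _)
      | mid z n =>
        rw [mid_le_mid_iff] at h1 h2 ⊢
        have := @hs x z
        grind
  match p, q with
  | .bot, q => exact ⟨bot, of_le (isBot_bot q)⟩
  | p, .bot => exact ⟨bot, swap (of_le (isBot_bot p))⟩
  | .top, q => exact ⟨q, swap (of_le (isTop_top q))⟩
  | p, .top => exact ⟨p, of_le (isTop_top p)⟩
  | .mid x l, .mid y m =>
    by_cases hxy : x = y
    · subst hxy
      rcases le_total l m with h | h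
      · exact ⟨_, of_le (mid_le_mid_iff.2 (.inl ⟨rfl, h⟩))⟩
      · exact ⟨_, swap (of_le (mid_le_mid_iff.2 (.inl ⟨rfl, h⟩)))⟩
    by_cases h1 : y = s x ∧ 2 ≤ m
    · obtain ⟨rfl, hm⟩ := h1
      exact ⟨_, adj x l m hm⟩
    by_cases h2 : x = s y ∧ 2 ≤ l
    · obtain ⟨rfl, hl⟩ := h2
      exact ⟨_, swap (adj y m l hl)⟩
    refine ⟨bot, fun r _ => isBot_bot r, fun r hr => ?_⟩
    have h3 : r ≤ mid x l := hr (by simp)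
    have h4 : r ≤ mid y m := hr (by simp)
    cases r with
    | bot => exact le_rfl
    | top => exact absurd h3 (not_top_le_mid _ _)
    | mid z n =>
      rw [mid_le_mid_iff] at h3 h4
      grind

/-! ### Labelled crowns and their homomorphisms -/

/-- A choice of labels for the four levels over a point of each colour. Levels `1` and `2` carry
the information; levels `0` and `3` only separate them from the bottom and the top, so that
consecutive points of a maximal chain always have different labels. -/
structure Palette {k : ℕ} (a b : Fin k) where
  /-- the label at the given level over a point of the given colour -/
  label : ZMod 3 → Fin 4 → Fin k
  injective : Function.Injective (label · 1)
  label_two (c : ZMod 3) : label c 2 = label (c + 1) 1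
  label_zero_ne (c : ZMod 3) : label c 0 ≠ label c 1
  label_zero_ne_bot (c : ZMod 3) : label c 0 ≠ b
  label_three_ne (c : ZMod 3) : label c 3 ≠ label c 2
  label_three_ne_top (c : ZMod 3) : label c 3 ≠ a

variable {k : ℕ} {a b : Fin k}

lemma nonempty_palette (hk : 3 ≤ k) (a b : Fin k) : Nonempty (Palette a b) := by
  have avoid (i j : Fin k) : ∃ c, c ≠ i ∧ c ≠ j := by
    have h : ({i, j} : Finset (Fin k)).card < (Finset.univ : Finset (Fin k)).card :=
      (Finset.card_le_two).trans_lt (by simpa using Nat.lt_of_succ_le hk)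
    obtain ⟨c, _, hc⟩ := Finset.exists_mem_notMem_of_card_lt_card h
    exact ⟨c, by simpa using hc⟩
  let ι : ZMod 3 → Fin k := Fin.castLE hk
  have hι : ι.Injective := Fin.castLE_injective hk
  choose d hd using fun c => avoid (ι c) b
  choose e he using fun c => avoid (ι (c + 1)) a
  exact ⟨{
    label := fun c => ![d c, ι c, ι (c + 1), e c]
    injective := hι
    label_two := fun _ => rfl
    label_zero_ne := fun c => (hd c).1
    label_zero_ne_bot := fun c => (hd c).2
    label_three_ne := fun c => (he c).1
    label_three_ne_top := fun c => (he c).2 }⟩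

/-- The label of a point of `Crown s`, for a colouring `χ`. -/
def label (P : Palette a b) (χ : X → ZMod 3) : Crown s → Fin k
  | bot => b
  | mid x l => P.label (χ x) l
  | top => a

variable {P : Palette a b} {χ : X → ZMod 3} {ψ : Y → ZMod 3}

/-- A label- and order-preserving map preserves levels, because it is strictly increasing on the
maximal chain through the given point. -/
lemma exists_eq_mid {F : Crown s → Crown t} (hF : Monotone F)
    (hl : ∀ p, label P ψ (F p) = label P χ p) (x : X) (l : Fin 4) :
    ∃ y, F (mid x l) = mid y l := by
  have step {p q : Crown s} (h : p ≤ q) (hne : label P χ p ≠ label P χ q) :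
      (F p).rank < (F q).rank :=
    rank_strictMono ((hF h).lt_of_ne fun h' => hne (by rw [← hl, ← hl, h']))
  have h0 := step (isBot_bot (mid x 0)) (P.label_zero_ne_bot (χ x)).symm
  have h1 := step (.chain x (by decide : (0 : Fin 4) ≤ 1)) (P.label_zero_ne (χ x))
  have h2 := step (.chain x (by decide : (1 : Fin 4) ≤ 2)) (by
    change P.label (χ x) 1 ≠ P.label (χ x) 2
    rw [P.label_two]
    exact fun h => by simpa using P.injective h)
  have h3 := step (.chain x (by decide : (2 : Fin 4) ≤ 3)) (P.label_three_ne (χ x)).symm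
  have h4 := step (isTop_top (mid x 3)) (P.label_three_ne_top (χ x))
  have h5 : (F top).rank ≤ 5 := by
    generalize F top = p
    cases p <;> simp [rank]; omega
  have h6 : (F (mid x l)).rank = l + 1 := by
    fin_cases l <;> simp <;> omega
  generalize F (mid x l) = p at h6
  cases p with
  | bot => simp [rank] at h6
  | mid y m =>
    refine ⟨y, ?_⟩
    simp only [rank] at h6
    congr 1
    omega
  | top => simp [rank] at h6; omega

/-- `Crown s` as a `k`-poset. -/
def toFinKPoset [Finite X] (s : X → X) (P : Palette a b) (χ : X → ZMod 3) : FinKPoset k where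
  carrier := Crown s
  label := label P χ

variable [Finite X] [Finite Y]

lemma isBoundedWithLabels : (toFinKPoset s P χ).IsBoundedWithLabels a b :=
  ⟨⟨top, isTop_top, rfl⟩, ⟨bot, isBot_bot, rfl⟩⟩

lemma isKLattice (hs : s.Injective) (hχ : ∀ x, χ (s x) = χ x + 1) :
    (toFinKPoset s P χ).IsKLattice := by
  have hs2 (x : X) : s (s x) ≠ x := fun h => by
    have h1 := congrArg χ h
    rw [hχ, hχ] at h1
    generalize χ x = c at h1
    revert c
    decide
  exact ⟨⟨bot⟩, fun p q => ⟨exists_isLUB hs hs2 p q, exists_isGLB hs hs2 p q⟩⟩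

/-- A colour-preserving map that commutes with the self-maps induces a homomorphism. -/
lemma toFinKPoset_le (g : X → Y) (hg : ∀ x, g (s x) = t (g x)) (hc : ∀ x, ψ (g x) = χ x) :
    toFinKPoset s P χ ≤ toFinKPoset t P ψ := by
  let F : Crown s → Crown t
    | bot => bot
    | mid x l => mid (g x) l
    | top => top
  refine ⟨⟨⟨F, fun p q h => ?_⟩, fun p => ?_⟩⟩
  · cases h with
    | bot => exact isBot_bot _
    | top => exact isTop_top _
    | chain x h => exact mid_le_mid_iff.2 (.inl ⟨rfl, h⟩)
    | cross x hl hm => exact mid_le_mid_iff.2 (.inr ⟨hg x, hl, hm⟩)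
  · change label P ψ (F p) = label P χ p
    cases p with
    | bot => rfl
    | mid x l => exact congrArg (P.label · l) (hc x)
    | top => rfl

/-- A homomorphism between labelled crowns comes from a map commuting with the self-maps. -/
lemma exists_semiconj_of_hom (hψ : ∀ y, ψ (t y) = ψ y + 1) (hχ : ∀ x, χ (s x) = χ x + 1)
    (h : toFinKPoset s P χ ≤ toFinKPoset t P ψ) : ∃ g : X → Y, ∀ x, g (s x) = t (g x) := by
  obtain ⟨⟨⟨F, hF⟩, hl⟩⟩ := h
  change Crown s → Crown t at F
  change ∀ p : Crown s, label P ψ (F p) = label P χ p at hl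
  replace hF : Monotone F := hF
  choose g hg using fun x => exists_eq_mid hF hl x 1
  choose v hv using fun x => exists_eq_mid hF hl x 2
  have hgc (x : X) : ψ (g x) = χ x := by
    have := hl (mid x 1)
    rw [hg] at this
    exact P.injective this
  have hvc (x : X) : ψ (v x) = χ x := by
    have := hl (mid x 2)
    rw [hv] at this
    change P.label _ 2 = P.label _ 2 at this
    rw [P.label_two, P.label_two] at this
    exact add_right_cancel (P.injective this)
  have hvg (x : X) : v x = g x := by
    have := hF (Le.chain x (by decide : (1 : Fin 4) ≤ 2))
    rw [hg, hv, mid_le_mid_iff] at this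
    rcases this with h | h
    · exact h.1.symm
    · have h1 := hvc x
      rw [h.1, hψ, hgc] at h1
      simp at h1
  refine ⟨g, fun x => ?_⟩
  have := hF (Le.cross x (le_refl (1 : Fin 4)) (le_refl (2 : Fin 4)))
  rw [hg, hv, mid_le_mid_iff, hvg] at this
  rcases this with h | h
  · have h1 := hgc (s x)
    rw [← h.1, hgc, hχ] at h1
    simp at h1
  · exact h.1

end Crown

/-! ### Disjoint unions of cycles -/

/-- The disjoint union of cycles of lengths `3 n`, `n ∈ A`. -/
abbrev Cycles (A : Finset ℕ+) : Type := Σ n : A, ZMod (3 * (n : ℕ+) : ℕ)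

namespace Cycles

variable {A B : Finset ℕ+}

/-- The rotation of all cycles by one step. -/
def rot (x : Cycles A) : Cycles A := ⟨x.1, x.2 + 1⟩

/-- The position on the cycle modulo `3`. -/
def colour (x : Cycles A) : ZMod 3 := ZMod.castHom (dvd_mul_right 3 _) (ZMod 3) x.2

lemma colour_rot (x : Cycles A) : colour (rot x) = colour x + 1 :=
  let φ := ZMod.castHom (dvd_mul_right 3 (x.1 : ℕ)) (ZMod 3)
  (φ.map_add x.2 1).trans (congrArg (φ x.2 + ·) φ.map_one)

lemma rot_injective : Function.Injective (rot : Cycles A → Cycles A) := by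
  rintro ⟨n, i⟩ ⟨m, j⟩ h
  simp only [rot, Sigma.mk.injEq] at h
  obtain ⟨rfl, h⟩ := h
  rw [add_right_cancel (eq_of_heq h)]

lemma rot_iterate (x : Cycles A) (r : ℕ) : rot^[r] x = ⟨x.1, x.2 + r⟩ := by
  induction r with
  | zero => simp
  | succ r ih => rw [Function.iterate_succ_apply', ih]; simp [rot, add_assoc]

/-- Going once around a cycle of length `3 n` must close up in its image, a cycle of length
`3 m`. -/
lemma exists_dvd_of_semiconj {g : Cycles A → Cycles B} (hg : ∀ x, g (rot x) = rot (g x)) :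
    ∀ n ∈ A, ∃ m ∈ B, (m : ℕ) ∣ n := by
  intro n hn
  have h := (Function.Semiconj.iterate_right (f := g) hg (3 * n)).eq ⟨⟨n, hn⟩, 0⟩
  rw [rot_iterate, rot_iterate] at h
  simp only [ZMod.natCast_self, add_zero] at h
  generalize g ⟨⟨n, hn⟩, 0⟩ = y at h
  obtain ⟨⟨m, hm⟩, j⟩ := y
  refine ⟨m, hm, ?_⟩
  simp only [Sigma.mk.injEq, heq_eq_eq, true_and, left_eq_add] at h
  rw [ZMod.natCast_eq_zero_iff] at h
  exact Nat.dvd_of_mul_dvd_mul_left (by norm_num) h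

lemma exists_semiconj (h : ∀ n ∈ A, ∃ m ∈ B, (m : ℕ) ∣ n) :
    ∃ g : Cycles A → Cycles B, (∀ x, g (rot x) = rot (g x)) ∧ ∀ x, colour (g x) = colour x := by
  choose m hm hdvd using h
  refine ⟨fun x => ⟨⟨m x.1 x.1.2, hm _ _⟩,
    ZMod.castHom (mul_dvd_mul_left 3 (hdvd x.1 x.1.2)) _ x.2⟩, fun x => ?_, fun x => ?_⟩
  · let φ := ZMod.castHom (mul_dvd_mul_left 3 (hdvd x.1 x.1.2)) (ZMod (3 * (m x.1 x.1.2 : ℕ)))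
    exact congrArg (Sigma.mk _) ((φ.map_add x.2 1).trans (congrArg (φ x.2 + ·) φ.map_one))
  · exact congrArg (fun φ : _ →+* _ => φ x.2)
      (RingHom.ext_zmod ((ZMod.castHom (dvd_mul_right 3 _) _).comp (ZMod.castHom _ _)) _)

end Cycles

/-- The labelled crown of a disjoint union of cycles, as a bounded `k`-lattice. -/
def cycleLattice {k : ℕ} {a b : Fin k} (P : Crown.Palette a b) (A : Finset ℕ+) :
    BoundedKLattice k a b :=
  ⟨Crown.toFinKPoset Cycles.rot P (Cycles.colour (A := A)),
    Crown.isKLattice Cycles.rot_injective Cycles.colour_rot, Crown.isBoundedWithLabels⟩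

lemma cycleLattice_le_iff {k : ℕ} {a b : Fin k} (P : Crown.Palette a b) (A B : Finset ℕ+) :
    (cycleLattice P A).1 ≤ (cycleLattice P B).1 ↔ ∀ n ∈ A, ∃ m ∈ B, (m : ℕ) ∣ n := by
  constructor
  · intro h
    obtain ⟨g, hg⟩ := Crown.exists_semiconj_of_hom Cycles.colour_rot Cycles.colour_rot h
    exact Cycles.exists_dvd_of_semiconj hg
  · intro h
    obtain ⟨g, hg, hc⟩ := Cycles.exists_semiconj h
    exact Crown.toFinKPoset_le g hg hc

/-! ### Countability -/

/-- Finite `k`-posets have countably many isomorphism types. -/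
lemma FinKPoset.exists_countable_code (k : ℕ) :
    ∃ (C : Type) (_ : Countable C) (code : FinKPoset k → C),
      ∀ P Q, code P = code Q → P ≤ Q := by
  let e (P : FinKPoset k) : P ≃ Fin (Nat.card P) := Finite.equivFin P
  refine ⟨Σ n : ℕ, (Fin n → Fin n → Prop) × (Fin n → Fin k), inferInstance,
    fun P => ⟨Nat.card P, fun i j => (e P).symm i ≤ (e P).symm j,
      fun i => P.label ((e P).symm i)⟩, fun P Q h => ?_⟩
  -- the cardinalities have to become variables before they can be identified
  dsimp only at h
  generalize e P = f at h
  generalize e Q = g at h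
  generalize Nat.card P = n at f h
  generalize Nat.card Q = m at g h
  obtain ⟨rfl, h⟩ := Sigma.mk.inj h
  obtain ⟨h1, h2⟩ := Prod.mk.inj (eq_of_heq h)
  refine ⟨⟨⟨fun x => g.symm (f x), fun x y hxy => ?_⟩, fun x => ?_⟩⟩
  · have := congrFun (congrFun h1 (f x)) (f y)
    simp only [Equiv.symm_apply_apply] at this
    exact this.mp hxy
  · have := congrFun h2 (f x)
    simp only [Equiv.symm_apply_apply] at this
    exact this.symm

/-- A class of finite `k`-posets that contains the lattices `cycleLattice P A` is universal. -/
lemma isUniversalPoset_of_cycleLattice_mem {k : ℕ} {a b : Fin k} (P : Crown.Palette a b)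
    (p : FinKPoset k → Prop) (hp : ∀ A, p (cycleLattice P A).1) :
    IsUniversalPoset.{u, 1} (Antisymmetrization {Q : FinKPoset k // p Q} (· ≤ ·)) := by
  constructor
  · obtain ⟨C, _, code, hcode⟩ := FinKPoset.exists_countable_code k
    refine Function.Injective.countable (f := fun q => code (ofAntisymmetrization (· ≤ ·) q).1)
      fun q r h => ?_
    exact le_antisymm (ofAntisymmetrization_le_ofAntisymmetrization_iff.1 (hcode _ _ h))
      (ofAntisymmetrization_le_ofAntisymmetrization_iff.1 (hcode _ _ h.symm))
  · intro Y _ _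
    obtain ⟨f, hf⟩ := exists_divisor_representation Y
    refine ⟨OrderEmbedding.ofMapLEIff
      (fun y => toAntisymmetrization (· ≤ ·) ⟨(cycleLattice P (f y)).1, hp _⟩) fun y z => ?_⟩
    rw [toAntisymmetrization_le_toAntisymmetrization_iff, hf y z, ← cycleLattice_le_iff P]
    rfl

theorem mainTheorem6 (k : ℕ) (hk : 3 ≤ k) (a b : Fin k) :
    IsUniversalPoset.{u, 1} (BoundedKPosetOrder k a b) ∧
      IsUniversalPoset.{u, 1} (BoundedKLatticeOrder k a b) := by
  obtain ⟨P⟩ := Crown.nonempty_palette hk a b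
  exact ⟨isUniversalPoset_of_cycleLattice_mem P _ fun A => (cycleLattice P A).2.2,
    isUniversalPoset_of_cycleLattice_mem P _ fun A => (cycleLattice P A).2⟩
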